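/- For a finite simple graph $G$ with vertex set $V$, let $S(G)$ be the set of all real symmetric matrices $A=(a_{ij})$ with rows and columns indexed by $V$ such that, for $i\neq j$, $a_{ij}\neq 0$ if and only if $i$ and $j$ are adjacent in $G$ (the diagonal entries are unrestricted). Let $q(A)$ be the number of distinct eigenvalues of $A$, and let $q(G)=\min\{q(A): A\in S(G)\}$. The join $G\vee H$ is the graph obtained from the disjoint union of $G$ and $H$ by adding all edges with one endpoint in $G$ and one endpoint in $H$, and $P_m$ is the path on $m$ vertices. Let $m>1$ be an integer and let $G$ be a connected graph with $n$ vertices (so $n\ge 1$), where $n\leq m$. Then $$q(G\vee P_m)=\left\lceil \frac{n+m}{n+1}\right\rceil.$$ -/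

import Mathlib

/-- `S(G)`: the real symmetric matrices indexed by the vertices of `G` whose off-diagonal `(i, j)`
entry is nonzero exactly when `i` and `j` are adjacent (the diagonal is unrestricted). -/
def matricesOfGraph {V : Type*} (G : SimpleGraph V) : Set (Matrix V V ℝ) :=
  {A | A.IsSymm ∧ ∀ i j, i ≠ j → (A i j ≠ 0 ↔ G.Adj i j)}

/-- `q(A)`: the number of distinct (real) eigenvalues of a square real matrix `A`. -/
noncomputable def numDistinctEigenvalues {V : Type*} [Fintype V] [DecidableEq V]
    (A : Matrix V V ℝ) : ℕ :=
  (spectrum ℝ A).ncard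

/-- `q(G)`: the minimum of `q(A)` over `A ∈ S(G)`. -/
noncomputable def minDistinctEigenvalues {V : Type*} [Fintype V] [DecidableEq V]
    (G : SimpleGraph V) : ℕ :=
  sInf (numDistinctEigenvalues '' matricesOfGraph G)

/-- The infimum defining `q(G)` is a genuine minimum: `S(G)` is never empty. -/
theorem isLeast_minDistinctEigenvalues {V : Type*} [Fintype V] [DecidableEq V]
    (G : SimpleGraph V) :
    IsLeast (numDistinctEigenvalues '' matricesOfGraph G) (minDistinctEigenvalues G) := by
  classical
  have hne : (numDistinctEigenvalues '' matricesOfGraph G).Nonempty := by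
    refine ⟨_, G.adjMatrix ℝ, ⟨G.isSymm_adjMatrix, ?_⟩, rfl⟩
    intro i j _
    simp [SimpleGraph.adjMatrix_apply]
  exact ⟨Nat.sInf_mem hne, fun _ h => Nat.sInf_le h⟩

/-- The join `G ∨ H`: the disjoint union of `G` and `H`, together with all edges having one
endpoint in `G` and the other in `H`. -/
def graphJoin {V W : Type*} (G : SimpleGraph V) (H : SimpleGraph W) : SimpleGraph (V ⊕ W) :=
  (G ⊕g H) ⊔ completeBipartiteGraph V W

theorem graphJoin_adj_inl_inl {V W : Type*} {G : SimpleGraph V} {H : SimpleGraph W} {u v : V} :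
    (graphJoin G H).Adj (Sum.inl u) (Sum.inl v) ↔ G.Adj u v := by
  simp [graphJoin]

theorem graphJoin_adj_inr_inr {V W : Type*} {G : SimpleGraph V} {H : SimpleGraph W} {u v : W} :
    (graphJoin G H).Adj (Sum.inr u) (Sum.inr v) ↔ H.Adj u v := by
  simp [graphJoin]

theorem graphJoin_adj_inl_inr {V W : Type*} {G : SimpleGraph V} {H : SimpleGraph W} {u : V}
    {v : W} : (graphJoin G H).Adj (Sum.inl u) (Sum.inr v) := by
  simp [graphJoin]

theorem graphJoin_adj_inr_inl {V W : Type*} {G : SimpleGraph V} {H : SimpleGraph W} {u : V}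
    {v : W} : (graphJoin G H).Adj (Sum.inr v) (Sum.inl u) := by
  simp [graphJoin]

/-- An eigenvector of a matrix of `G ∨ P_m` vanishing on `G` and at the first vertex of the path
vanishes identically. -/
theorem eq_zero_of_mulVec_eq_smul {V : Type*} [Fintype V] {G : SimpleGraph V}
    {m : ℕ} (hm : 0 < m) {A : Matrix (V ⊕ Fin m) (V ⊕ Fin m) ℝ}
    (hA : A ∈ matricesOfGraph (graphJoin G (SimpleGraph.pathGraph m))) {μ : ℝ}
    {x : V ⊕ Fin m → ℝ} (hx : A.mulVec x = μ • x) (hV : ∀ v, x (Sum.inl v) = 0)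
    (h0 : x (Sum.inr ⟨0, hm⟩) = 0) : x = 0 := by
  have key : ∀ j : ℕ, ∀ hj : j < m, x (Sum.inr ⟨j, hj⟩) = 0 := by
    intro j
    induction j using Nat.strong_induction_on with
    | _ j ih =>
      intro hj
      rcases j with _ | j
      · exact h0
      · have hj' : j < m := by omega
        have h1 := congrFun hx (Sum.inr ⟨j, hj'⟩)
        simp only [Matrix.mulVec, dotProduct, Fintype.sum_sum_type, hV, mul_zero,
          Finset.sum_const_zero, zero_add, Pi.smul_apply, smul_eq_mul,
          ih j (by omega) hj'] at h1
        rw [Finset.sum_eq_single ⟨j + 1, hj⟩] at h1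
        · refine (mul_eq_zero.mp h1).resolve_left ((hA.2 _ _ (by simp)).mpr ?_)
          rw [graphJoin_adj_inr_inr, SimpleGraph.pathGraph_adj]
          simp
        · intro i _ hi
          rcases lt_trichotomy i.1 (j + 1) with h | h | h
          · rw [ih i.1 h i.2, mul_zero]
          · exact absurd (Fin.ext h) hi
          · have : A (Sum.inr ⟨j, hj'⟩) (Sum.inr i) = 0 := by
              by_contra hne
              rw [← ne_eq, hA.2 _ _ (by simp [Fin.ext_iff]; omega), graphJoin_adj_inr_inr,
                SimpleGraph.pathGraph_adj] at hne
              simp at hne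
              omega
            rw [this, zero_mul]
        · simp
  ext (v | j)
  · exact hV v
  · exact key j.1 j.2

/-- Every eigenspace of a matrix of `G ∨ P_m` has dimension at most `|G| + 1`. -/
theorem finrank_ker_le_card_add_one {V : Type*} [Fintype V] [DecidableEq V] {G : SimpleGraph V}
    {m : ℕ} (hm : 0 < m) {A : Matrix (V ⊕ Fin m) (V ⊕ Fin m) ℝ}
    (hA : A ∈ matricesOfGraph (graphJoin G (SimpleGraph.pathGraph m))) (μ : ℝ) :
    Module.finrank ℝ (LinearMap.ker (A.mulVecLin - μ • LinearMap.id)) ≤ Fintype.card V + 1 := by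
  let E := LinearMap.ker (A.mulVecLin - μ • LinearMap.id)
  let φ : (V ⊕ Fin m → ℝ) →ₗ[ℝ] (V → ℝ) × ℝ :=
    (LinearMap.funLeft ℝ ℝ Sum.inl).prod (LinearMap.proj (Sum.inr ⟨0, hm⟩))
  have hinj : Function.Injective (φ.comp E.subtype) := by
    rw [← LinearMap.ker_eq_bot, LinearMap.ker_eq_bot']
    rintro ⟨x, hx⟩ h
    have h1 : (φ x).1 = 0 := congrArg Prod.fst h
    have h2 : (φ x).2 = 0 := congrArg Prod.snd h
    rw [LinearMap.mem_ker] at hx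
    simp only [LinearMap.sub_apply, Matrix.mulVecLin_apply, LinearMap.smul_apply,
      LinearMap.id_apply, sub_eq_zero] at hx
    exact Subtype.ext (eq_zero_of_mulVec_eq_smul hm hA hx (fun v => congrFun h1 v) h2)
  have := LinearMap.finrank_le_finrank_of_injective hinj
  simpa using this

theorem card_add_le_mul_numDistinctEigenvalues {V : Type*} [Fintype V] [DecidableEq V]
    {G : SimpleGraph V} {m : ℕ} (hm : 0 < m) {A : Matrix (V ⊕ Fin m) (V ⊕ Fin m) ℝ}
    (hA : A ∈ matricesOfGraph (graphJoin G (SimpleGraph.pathGraph m))) :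
    Fintype.card V + m ≤ (Fintype.card V + 1) * numDistinctEigenvalues A := by
  have hH : A.IsHermitian := by
    have := hA.1
    rwa [Matrix.IsHermitian, Matrix.conjTranspose_eq_transpose_of_trivial]
  have h1 : Finset.card (Finset.univ : Finset (V ⊕ Fin m)) ≤
      (Fintype.card V + 1) * (Finset.univ.image hH.eigenvalues).card := by
    refine Finset.card_le_mul_card_image _ _ fun μ _ => ?_
    refine le_trans ?_ (finrank_ker_le_card_add_one hm hA μ)
    let f : {i // i ∈ Finset.univ.filter fun i => hH.eigenvalues i = μ} →
        LinearMap.ker (A.mulVecLin - μ • LinearMap.id) := fun i =>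
      ⟨(hH.eigenvectorBasis i.1).ofLp, by
        have hi : hH.eigenvalues i.1 = μ := (Finset.mem_filter.mp i.2).2
        have := hH.mulVec_eigenvectorBasis i.1
        rw [hi] at this
        simp [LinearMap.mem_ker, this]⟩
    have hf : LinearIndependent ℝ f := by
      apply LinearIndependent.of_comp (Submodule.subtype _)
      have hb := hH.eigenvectorBasis.orthonormal.linearIndependent
      have h2 := hb.map' (WithLp.linearEquiv 2 ℝ (V ⊕ Fin m → ℝ)).toLinearMap
        (LinearEquiv.ker _)
      exact h2.comp (fun i : {i // i ∈ Finset.univ.filter fun i => hH.eigenvalues i = μ} => i.1)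
        Subtype.val_injective
    have := hf.fintype_card_le_finrank
    rwa [Fintype.card_coe] at this
  have h2 : (Finset.univ.image hH.eigenvalues).card = numDistinctEigenvalues A := by
    rw [numDistinctEigenvalues, hH.spectrum_real_eq_range_eigenvalues, ← Set.ncard_coe_finset]
    simp
  rw [h2] at h1
  simpa using h1

/-- The weight at `j` of the arrow matrix with shaft `d` and eigenvalues `ν`. -/
noncomputable def arrowWeight {s : ℕ} (ν : Fin (s + 1) → ℝ) (d : Fin s → ℝ) (j : Fin s) : ℝ :=
  -(∏ i, (d j - ν i)) * Lagrange.nodalWeight Finset.univ d j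

theorem strictMono_of_interlace {s : ℕ} {ν : Fin (s + 1) → ℝ} {d : Fin s → ℝ}
    (hν : StrictMono ν) (h1 : ∀ i, ν i.castSucc < d i) (h2 : ∀ i, d i < ν i.succ) :
    StrictMono d := fun i i' h => by
  have : i.succ ≤ i'.castSucc := by
    rw [Fin.le_def, Fin.val_succ, Fin.val_castSucc]
    exact h
  exact (h2 i).trans_le ((hν.monotone this).trans (h1 i').le)

theorem arrowWeight_pos {s : ℕ} {ν : Fin (s + 1) → ℝ} {d : Fin s → ℝ}
    (hν : StrictMono ν) (h1 : ∀ i, ν i.castSucc < d i) (h2 : ∀ i, d i < ν i.succ) (j : Fin s) :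
    0 < arrowWeight ν d j := by
  have hd : ∀ i i', i < i' → d i < d i' := fun i i' h => strictMono_of_interlace hν h1 h2 h
  rw [arrowWeight, Fin.prod_univ_succAbove _ j.castSucc, Lagrange.nodalWeight,
    ← Finset.mul_prod_erase _ _ (Finset.mem_univ j)]
  have e : j.castSucc.succAbove j = j.succ := by simp
  rw [e]
  have hp : 0 < (∏ i ∈ Finset.univ.erase j, (d j - ν (j.castSucc.succAbove i))) *
      ∏ i ∈ Finset.univ.erase j, (d j - d i)⁻¹ := by
    rw [← Finset.prod_mul_distrib]
    refine Finset.prod_pos fun i hi => ?_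
    rcases lt_or_gt_of_ne (Finset.ne_of_mem_erase hi) with h | h
    · rw [Fin.succAbove_of_castSucc_lt _ _ (by simpa using h)]
      exact mul_pos (sub_pos.2 ((h1 i).trans (hd i j h))) (inv_pos.2 (sub_pos.2 (hd i j h)))
    · rw [Fin.succAbove_of_le_castSucc _ _ (by simpa using h.le)]
      exact mul_pos_of_neg_of_neg (sub_neg.2 ((hd j i h).trans (h2 i)))
        (inv_lt_zero.2 (sub_neg.2 (hd j i h)))
  have ha : 0 < d j - ν j.castSucc := sub_pos.2 (h1 j)
  have hb : 0 < -(d j - ν j.succ) := by linarith [h2 j]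
  have := mul_pos (mul_pos ha hb) hp
  linarith

/-- The partial fraction expansion of the characteristic polynomial of an arrow matrix. -/
theorem prod_sub_eq_prod_sub_mul {s : ℕ} {ν : Fin (s + 1) → ℝ} {d : Fin s → ℝ}
    (hd : Function.Injective d) {c : ℝ} (hc : c = ∑ i, ν i - ∑ i, d i) {x : ℝ}
    (hx : ∀ i, x ≠ d i) :
    ∏ i, (x - ν i) =
      (∏ i, (x - d i)) * (x - c - ∑ i, arrowWeight ν d i * (x - d i)⁻¹) := by
  open Polynomial in
  set N : ℝ[X] := ∏ i, (X - C (ν i)) with hN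
  set P : ℝ[X] := ∏ i, (X - C (d i)) with hP
  have hNm : N.Monic := monic_prod_X_sub_C _ _
  have hPm : P.Monic := monic_prod_X_sub_C _ _
  have hQm : (P * (X - C c)).Monic := hPm.mul (monic_X_sub_C c)
  have hNd : N.natDegree = s + 1 := by simp [hN]
  have hQd : (P * (X - C c)).natDegree = s + 1 := by
    rw [hPm.natDegree_mul (monic_X_sub_C c)]
    simp [hP]
  have hnext : N.nextCoeff = (P * (X - C c)).nextCoeff := by
    rw [hPm.nextCoeff_mul (monic_X_sub_C c), hN, hP, prod_X_sub_C_nextCoeff,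
      prod_X_sub_C_nextCoeff, nextCoeff_X_sub_C, hc]
    ring
  have hdeg : (P * (X - C c) - N).degree <
      ((Finset.univ : Finset (Fin s)).card : WithBot ℕ) := by
    rw [Finset.card_fin, degree_lt_iff_coeff_zero]
    intro k hk
    rw [coeff_sub]
    rcases Nat.lt_trichotomy k (s + 1) with h | h | h
    · obtain rfl : k = s := by omega
      rw [nextCoeff_of_natDegree_pos (by omega), nextCoeff_of_natDegree_pos (by omega), hNd, hQd]
        at hnext
      simpa [sub_eq_zero] using hnext.symm
    · rw [h]
      nth_rw 1 [← hQd]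
      rw [← hNd, hNm.coeff_natDegree, hQm.coeff_natDegree, sub_self]
    · rw [coeff_eq_zero_of_natDegree_lt (by omega), coeff_eq_zero_of_natDegree_lt (by omega),
        sub_self]
  have hR := congrArg (eval x) (Lagrange.eq_interpolate hd.injOn hdeg)
  rw [Lagrange.eval_interpolate_not_at_node _ (fun i _ => hx i)] at hR
  have hPx : ∀ y, P.eval y = ∏ i, (y - d i) := fun y => by simp [hP, eval_prod]
  have hNx : ∀ y, N.eval y = ∏ i, (y - ν i) := fun y => by simp [hN, eval_prod]
  have hP0 : ∀ i, P.eval (d i) = 0 := fun i => by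
    rw [hPx]; exact Finset.prod_eq_zero (Finset.mem_univ i) (sub_self _)
  simp only [eval_sub, eval_mul, hP0, eval_X, eval_C, zero_mul, zero_sub, Lagrange.eval_nodal,
    hNx, hPx] at hR
  have hs : ∑ i, Lagrange.nodalWeight Finset.univ d i * (x - d i)⁻¹ * -(∏ k, (d i - ν k)) =
      ∑ i, arrowWeight ν d i * (x - d i)⁻¹ :=
    Finset.sum_congr rfl fun i _ => by rw [arrowWeight]; ring
  rw [hs] at hR
  linear_combination -hR

/-- An arrow matrix with corner `c`, shaft `d` and border `√(arrowWeight ν d)` has no eigenvalues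
other than the `ν i`. -/
theorem arrow_eigenvector_eq_zero {s : ℕ} {ν : Fin (s + 1) → ℝ} {d : Fin s → ℝ}
    (hν : StrictMono ν) (h1 : ∀ i, ν i.castSucc < d i) (h2 : ∀ i, d i < ν i.succ)
    {c : ℝ} (hc : c = ∑ i, ν i - ∑ i, d i) {x : ℝ} (hx : ∀ i, x ≠ ν i) {a : ℝ} {u : Fin s → ℝ}
    (ha : c * a + ∑ i, √(arrowWeight ν d i) * u i = x * a)
    (hu : ∀ i, √(arrowWeight ν d i) * a + d i * u i = x * u i) : a = 0 ∧ ∀ i, u i = 0 := by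
  have hdm : StrictMono d := strictMono_of_interlace hν h1 h2
  have hw : ∀ i, √(arrowWeight ν d i) ≠ 0 := fun i =>
    (Real.sqrt_pos.2 (arrowWeight_pos hν h1 h2 i)).ne'
  by_cases hxd : ∃ i, x = d i
  · obtain ⟨j, rfl⟩ := hxd
    have ha0 : a = 0 := by
      have := hu j
      simpa [hw j] using this
    subst ha0
    have hne : ∀ i, i ≠ j → u i = 0 := fun i hi => by
      have h3 : (d i - d j) * u i = 0 := by linear_combination hu i
      exact (mul_eq_zero.mp h3).resolve_left (sub_ne_zero.2 (hdm.injective.ne hi))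
    refine ⟨rfl, fun i => ?_⟩
    by_cases hi : i = j
    · subst hi
      rw [Finset.sum_eq_single i (fun k _ hk => by rw [hne k hk, mul_zero]) (by simp)] at ha
      simpa [hw i] using ha
    · exact hne i hi
  · push Not at hxd
    have hsub : ∀ i, x - d i ≠ 0 := fun i => sub_ne_zero.2 (hxd i)
    have hu' : ∀ i, u i = √(arrowWeight ν d i) * a * (x - d i)⁻¹ := fun i => by
      rw [eq_mul_inv_iff_mul_eq₀ (hsub i)]
      linear_combination -hu i
    have hs : ∑ i, √(arrowWeight ν d i) * u i =
        (∑ i, arrowWeight ν d i * (x - d i)⁻¹) * a := by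
      rw [Finset.sum_mul]
      refine Finset.sum_congr rfl fun i _ => ?_
      rw [hu' i]
      linear_combination a * (x - d i)⁻¹ * Real.mul_self_sqrt (arrowWeight_pos hν h1 h2 i).le
    rw [hs] at ha
    have h3 := prod_sub_eq_prod_sub_mul (ν := ν) hdm.injective hc hxd
    have h4 : ∏ i, (x - ν i) ≠ 0 := Finset.prod_ne_zero_iff.2 fun i _ => sub_ne_zero.2 (hx i)
    rw [h3] at h4
    have h5 : (x - c - ∑ i, arrowWeight ν d i * (x - d i)⁻¹) * a = 0 := by linear_combination -ha
    have ha0 := (mul_eq_zero.mp h5).resolve_left (right_ne_zero_of_mul h4)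
    exact ⟨ha0, fun i => by rw [hu' i, ha0]; simp⟩

/-- Every symmetric matrix pattern is realised by a matrix with simple spectrum. -/
theorem exists_mem_matricesOfGraph_injective_eigenvalues {V : Type*} [Fintype V] [DecidableEq V]
    (G : SimpleGraph V) : ∃ (U : Matrix V V ℝ) (l : V → ℝ), U * U.transpose = 1 ∧
      Function.Injective l ∧
      U * Matrix.diagonal l * U.transpose ∈ matricesOfGraph G := by
  classical
  obtain ⟨e⟩ : Nonempty (V ≃ Fin (Fintype.card V)) := ⟨Fintype.equivFin V⟩
  set n := Fintype.card V
  let δ : V → ℝ := fun v => 2 * ((n : ℝ) + 1) * ((e v : ℕ) : ℝ)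
  let A : Matrix V V ℝ := Matrix.diagonal δ + G.adjMatrix ℝ
  have hAs : A.IsSymm := by
    simp [A, Matrix.IsSymm, Matrix.transpose_add]
  have hH : A.IsHermitian := by
    rwa [Matrix.IsHermitian, Matrix.conjTranspose_eq_transpose_of_trivial]
  let U : Matrix V V ℝ := hH.eigenvectorUnitary
  have hUU : U * U.transpose = 1 := by
    have := Matrix.mem_unitaryGroup_iff.mp hH.eigenvectorUnitary.2
    rwa [Matrix.star_eq_conjTranspose, Matrix.conjTranspose_eq_transpose_of_trivial] at this
  have hUU' : U.transpose * U = 1 := mul_eq_one_comm.mp hUU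
  have hspec : A = U * Matrix.diagonal hH.eigenvalues * U.transpose := by
    have := hH.spectral_theorem
    rw [Unitary.conjStarAlgAut_apply, Matrix.star_eq_conjTranspose,
      Matrix.conjTranspose_eq_transpose_of_trivial] at this
    simpa using this
  have hclose : ∀ v, ∃ i, |hH.eigenvalues i - δ v| < n + 1 := by
    intro v
    by_contra! hcon
    have hB : A - Matrix.diagonal (fun _ => δ v) =
        U * Matrix.diagonal (fun i => hH.eigenvalues i - δ v) * U.transpose := by
      have h1 : Matrix.diagonal (fun i => hH.eigenvalues i - δ v) =
          Matrix.diagonal hH.eigenvalues - δ v • (1 : Matrix V V ℝ) := by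
        ext i j
        by_cases h : i = j <;> simp [h]
      have h2 : Matrix.diagonal (fun _ : V => δ v) = δ v • (1 : Matrix V V ℝ) := by
        ext i j
        by_cases h : i = j <;> simp [h]
      rw [h1, h2, mul_sub, sub_mul, ← hspec, Matrix.mul_smul, Matrix.smul_mul, mul_one, hUU]
    have hB2 : ((A - Matrix.diagonal (fun _ => δ v)) * (A - Matrix.diagonal (fun _ => δ v)) :
        Matrix V V ℝ) v v =
        ∑ i, (hH.eigenvalues i - δ v) ^ 2 * (U v i) ^ 2 := by
      have : (A - Matrix.diagonal (fun _ => δ v)) * (A - Matrix.diagonal (fun _ => δ v)) =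
          U * Matrix.diagonal (fun i => (hH.eigenvalues i - δ v) ^ 2) * U.transpose := by
        rw [hB]
        calc _ = U * Matrix.diagonal (fun i => hH.eigenvalues i - δ v) * (U.transpose * U) *
              Matrix.diagonal (fun i => hH.eigenvalues i - δ v) * U.transpose := by
                simp only [mul_assoc]
          _ = _ := by
                rw [hUU', mul_one, mul_assoc U, Matrix.diagonal_mul_diagonal]
                simp only [sq]
      rw [this, Matrix.mul_apply]
      refine Finset.sum_congr rfl fun i _ => ?_
      rw [Matrix.mul_diagonal, Matrix.transpose_apply]
      ring
    have hlow : ((n : ℝ) + 1) ^ 2 ≤ ∑ i, (hH.eigenvalues i - δ v) ^ 2 * (U v i) ^ 2 := by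
      have h1 : ∑ i, (U v i) ^ 2 = 1 := by
        have := congrFun (congrFun hUU v) v
        rw [Matrix.mul_apply, Matrix.one_apply_eq] at this
        rw [← this]
        exact Finset.sum_congr rfl fun i _ => by rw [Matrix.transpose_apply]; ring
      calc ((n : ℝ) + 1) ^ 2 = ∑ i, ((n : ℝ) + 1) ^ 2 * (U v i) ^ 2 := by
            rw [← Finset.mul_sum, h1, mul_one]
        _ ≤ _ := by
            refine Finset.sum_le_sum fun i _ => mul_le_mul_of_nonneg_right ?_ (sq_nonneg _)
            rw [← sq_abs (hH.eigenvalues i - δ v)]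
            exact pow_le_pow_left₀ (by positivity) (hcon i) 2
    have hup : ((A - Matrix.diagonal (fun _ => δ v)) * (A - Matrix.diagonal (fun _ => δ v)) :
        Matrix V V ℝ) v v ≤
        n := by
      rw [Matrix.mul_apply]
      calc _ ≤ ∑ _w : V, (1 : ℝ) := by
            refine Finset.sum_le_sum fun w _ => ?_
            by_cases h : v = w
            · subst h
              simp [A]
            · have h' : w ≠ v := Ne.symm h
              by_cases hadj : G.Adj v w
              · simp [A, Matrix.diagonal_apply_ne _ h, Matrix.diagonal_apply_ne _ h',
                  SimpleGraph.adjMatrix_apply, hadj, hadj.symm]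
              · simp [A, Matrix.diagonal_apply_ne _ h, Matrix.diagonal_apply_ne _ h',
                  SimpleGraph.adjMatrix_apply, hadj]
        _ = n := by simp [n]
    rw [hB2] at hup
    have : (0 : ℝ) ≤ n := by positivity
    nlinarith
  choose f hf using hclose
  have hsep : ∀ v w, hH.eigenvalues (f v) = hH.eigenvalues (f w) → v = w := by
    intro v w h
    have h1 := abs_lt.mp (hf v)
    have h2 := abs_lt.mp (hf w)
    rw [h] at h1
    by_contra hne
    have hne' : (e v : ℕ) ≠ (e w : ℕ) := fun h => hne (e.injective (Fin.ext h))
    have hn0 : (0 : ℝ) ≤ n := by positivity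
    simp only [δ] at h1 h2
    rcases Nat.lt_or_gt_of_ne hne' with h | h
    · have : ((e v : ℕ) : ℝ) + 1 ≤ (e w : ℕ) := by exact_mod_cast h
      nlinarith
    · have : ((e w : ℕ) : ℝ) + 1 ≤ (e v : ℕ) := by exact_mod_cast h
      nlinarith
  have hfb : Function.Bijective f := Finite.injective_iff_bijective.mp
    fun v w h => hsep v w (congrArg _ h)
  refine ⟨U, hH.eigenvalues, hUU, fun i j hij => ?_, ?_⟩
  · obtain ⟨v, rfl⟩ := hfb.2 i
    obtain ⟨w, rfl⟩ := hfb.2 j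
    rw [hsep v w hij]
  · rw [← hspec]
    refine ⟨hAs, fun i j hij => ?_⟩
    simp [A, Matrix.diagonal_apply_ne _ hij, SimpleGraph.adjMatrix_apply]

/-- For `i + 1` nodes and a suitable vector `b`, the only polynomial of degree at most `i` whose
multiple `p(D) b` is orthogonal to `b, D b, …, D ^ (i - 1) b` and to `z` is zero. -/
theorem exists_forall_coeff_eq_zero_of_orthogonal {J : Type*} [Fintype J]
    {d : J → ℝ} (hd : Function.Injective d) {z : J → ℝ} (hz : z ≠ 0) {i : ℕ}
    (hi : i < Fintype.card J) :
    ∃ b : J → ℝ, ∀ α : Fin (i + 1) → ℝ,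
      (∀ a < i, ∑ j, (∑ c, α c * d j ^ (c : ℕ)) * d j ^ a * b j ^ 2 = 0) →
      ∑ j, (∑ c, α c * d j ^ (c : ℕ)) * z j * b j = 0 → α = 0 := by
  classical
  obtain ⟨j₀, hj₀⟩ := Function.ne_iff.mp hz
  rw [Pi.zero_apply] at hj₀
  obtain ⟨S, hjS, -, hS⟩ := Finset.exists_subsuperset_card_eq
    (Finset.subset_univ ({j₀} : Finset J)) (n := i + 1) (by simp)
    (by rw [Finset.card_univ]; omega)
  rw [Finset.singleton_subset_iff] at hjS
  let r : J → Polynomial ℝ := fun s =>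
    ∏ k ∈ (S.erase j₀).erase s, (Polynomial.X - Polynomial.C (d k))
  have hr : ∀ s x, (r s).eval x = ∏ k ∈ (S.erase j₀).erase s, (x - d k) := fun s x => by
    simp [r, Polynomial.eval_prod]
  have hrs : ∀ s ∈ S.erase j₀, (r s).eval (d s) ≠ 0 := fun s _ => by
    rw [hr, Finset.prod_ne_zero_iff]
    exact fun k hk => sub_ne_zero.2 (hd.ne (Finset.ne_of_mem_erase hk).symm)
  have hrd : ∀ s ∈ S.erase j₀, (r s).natDegree < i := fun s hs => by
    have h1 : (r s).natDegree = ((S.erase j₀).erase s).card := by simp [r]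
    have h2 := Finset.card_pos.2 ⟨s, hs⟩
    rw [h1, Finset.card_erase_of_mem hs]
    rw [Finset.card_erase_of_mem hjS] at h2 ⊢
    omega
  let ρ : J → ℝ := fun s => -(r s).eval (d j₀) / (r s).eval (d s)
  obtain ⟨τ, hτ, hτR⟩ : ∃ τ : ℝ, τ ≠ 0 ∧ z j₀ + τ * ∑ s ∈ S.erase j₀, ρ s * z s ≠ 0 := by
    by_cases h : z j₀ + 1 * ∑ s ∈ S.erase j₀, ρ s * z s = 0
    · refine ⟨2, two_ne_zero, fun h' => hj₀ ?_⟩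
      linarith
    · exact ⟨1, one_ne_zero, h⟩
  refine ⟨fun j => if j ∈ S then if j = j₀ then τ else 1 else 0, fun α h1 h2 => ?_⟩
  set b : J → ℝ := fun j => if j ∈ S then if j = j₀ then τ else 1 else 0 with hb
  have hb0 : b j₀ = τ := by simp [hb, hjS]
  have hb1 : ∀ s ∈ S.erase j₀, b s = 1 := fun s hs => by
    simp [hb, Finset.mem_of_mem_erase hs, Finset.ne_of_mem_erase hs]
  have hbS : ∀ s, s ∉ S → b s = 0 := fun s hs => by simp [hb, hs]
  set p : Polynomial ℝ := ∑ c, Polynomial.C (α c) * Polynomial.X ^ (c : ℕ) with hp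
  have hpe : ∀ x, ∑ c, α c * x ^ (c : ℕ) = p.eval x := fun x => by
    simp [hp, Polynomial.eval_finsetSum]
  simp only [hpe] at h1 h2
  have h3 : ∀ q : Polynomial ℝ, q.natDegree < i →
      ∑ j, p.eval (d j) * q.eval (d j) * b j ^ 2 = 0 := by
    intro q hq
    have : ∀ j, p.eval (d j) * q.eval (d j) * b j ^ 2 =
        ∑ a ∈ Finset.range i, q.coeff a * (p.eval (d j) * d j ^ a * b j ^ 2) := fun j => by
      rw [Polynomial.eval_eq_sum_range' hq, Finset.mul_sum, Finset.sum_mul]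
      exact Finset.sum_congr rfl fun a _ => by ring
    simp only [this]
    rw [Finset.sum_comm]
    refine Finset.sum_eq_zero fun a ha => ?_
    rw [← Finset.mul_sum, h1 a (Finset.mem_range.1 ha), mul_zero]
  have h4 : ∀ s ∈ S.erase j₀, p.eval (d s) = τ ^ 2 * p.eval (d j₀) * ρ s := by
    intro s hs
    have h5 := h3 (r s) (hrd s hs)
    rw [Finset.sum_eq_add s j₀ (Finset.ne_of_mem_erase hs), hb0, hb1 s hs] at h5
    · have := hrs s hs
      simp only [ρ]
      field_simp
      linear_combination h5
    · rintro k - ⟨hks, hk0⟩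
      by_cases hkS : k ∈ S
      · rw [hr s (d k), Finset.prod_eq_zero (i := k) (by simp [hks, hk0, hkS]) (sub_self _)]
        ring
      · rw [hbS k hkS]
        ring
    · simp
    · simp
  have h5 : p.eval (d j₀) = 0 := by
    rw [← Finset.sum_subset (Finset.subset_univ S)
      (fun k _ hk => by rw [hbS k hk, mul_zero]), ← Finset.add_sum_erase _ _ hjS, hb0,
      Finset.sum_congr rfl (g := fun s => τ ^ 2 * p.eval (d j₀) * (ρ s * z s))
        (fun s hs => by rw [h4 s hs, hb1 s hs]; ring), ← Finset.mul_sum] at h2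
    have h6 : p.eval (d j₀) * (τ * (z j₀ + τ * ∑ s ∈ S.erase j₀, ρ s * z s)) = 0 := by
      linear_combination h2
    exact (mul_eq_zero.mp h6).resolve_right (mul_ne_zero hτ hτR)
  have hp0 : p = 0 := by
    refine Polynomial.eq_zero_of_degree_lt_of_eval_index_eq_zero S (v := d) hd.injOn ?_ ?_
    · rw [hS]
      exact Polynomial.degree_sum_fin_lt α
    · intro s hs
      by_cases hs0 : s = j₀
      · rw [hs0, h5]
      · rw [h4 s (Finset.mem_erase.2 ⟨hs0, hs⟩), h5]
        ring
  ext c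
  have := congrArg (fun q => q.coeff (c : ℕ)) hp0
  simpa [hp, Polynomial.finsetSum_coeff, Polynomial.coeff_X_pow, Fin.val_inj] using this

/-- A generic vector `b` has no zero entries and its Krylov vectors satisfy the conclusion of
`exists_forall_coeff_eq_zero_of_orthogonal` for all `i` and finitely many `z` at once. -/
theorem exists_generic_krylov {J V : Type*} [Fintype J] [Fintype V]
    {d : J → ℝ} (hd : Function.Injective d) {z : V → J → ℝ} (hz : ∀ v, z v ≠ 0) :
    ∃ b : J → ℝ, (∀ j, b j ≠ 0) ∧ ∀ v, ∀ i < Fintype.card J, ∀ α : Fin (i + 1) → ℝ,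
      (∀ a < i, ∑ j, (∑ c, α c * d j ^ (c : ℕ)) * d j ^ a * b j ^ 2 = 0) →
      ∑ j, (∑ c, α c * d j ^ (c : ℕ)) * z v j * b j = 0 → α = 0 := by
  classical
  let K : V → (i : ℕ) → Matrix (Fin (i + 1)) (Fin (i + 1)) (MvPolynomial J ℝ) := fun v i =>
    Matrix.of fun a c => if (a : ℕ) < i then
      ∑ j, MvPolynomial.C (d j ^ (c : ℕ) * d j ^ (a : ℕ)) * MvPolynomial.X j ^ 2
      else ∑ j, MvPolynomial.C (d j ^ (c : ℕ) * z v j) * MvPolynomial.X j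
  have hK : ∀ v i b (α : Fin (i + 1) → ℝ) (a : Fin (i + 1)),
      (((MvPolynomial.eval b).mapMatrix (K v i)).mulVec α) a = if (a : ℕ) < i then
        ∑ j, (∑ c, α c * d j ^ (c : ℕ)) * d j ^ (a : ℕ) * b j ^ 2
        else ∑ j, (∑ c, α c * d j ^ (c : ℕ)) * z v j * b j := by
    intro v i b α a
    simp only [Matrix.mulVec, dotProduct, RingHom.mapMatrix_apply, Matrix.map_apply, K,
      Matrix.of_apply]
    split_ifs with h
    · simp only [map_sum, map_mul, MvPolynomial.eval_C, map_pow, MvPolynomial.eval_X,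
        Finset.sum_mul]
      rw [Finset.sum_comm]
      exact Finset.sum_congr rfl fun j _ => Finset.sum_congr rfl fun c _ => by ring
    · simp only [map_sum, map_mul, MvPolynomial.eval_C, map_pow, MvPolynomial.eval_X,
        Finset.sum_mul]
      rw [Finset.sum_comm]
      exact Finset.sum_congr rfl fun j _ => Finset.sum_congr rfl fun c _ => by ring
  have hKz : ∀ v i b (α : Fin (i + 1) → ℝ),
      ((MvPolynomial.eval b).mapMatrix (K v i)).mulVec α = 0 ↔
      (∀ a < i, ∑ j, (∑ c, α c * d j ^ (c : ℕ)) * d j ^ a * b j ^ 2 = 0) ∧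
      ∑ j, (∑ c, α c * d j ^ (c : ℕ)) * z v j * b j = 0 := by
    intro v i b α
    constructor
    · intro h
      refine ⟨fun a ha => ?_, ?_⟩
      · have := congrFun h ⟨a, by omega⟩
        rwa [hK, if_pos ha] at this
      · have := congrFun h (Fin.last i)
        rwa [hK, if_neg (by simp)] at this
    · rintro ⟨h1, h2⟩
      ext a
      rw [hK]
      split_ifs with h
      · exact h1 a h
      · exact h2
  have hdet : ∀ v, ∀ i < Fintype.card J, (K v i).det ≠ 0 := by
    intro v i hi h
    obtain ⟨b, hb⟩ := exists_forall_coeff_eq_zero_of_orthogonal hd (hz v) hi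
    have h0 : ((MvPolynomial.eval b).mapMatrix (K v i)).det = 0 := by
      rw [← RingHom.map_det, h, map_zero]
    obtain ⟨α, hα, hKα⟩ := Matrix.exists_mulVec_eq_zero_iff.mpr h0
    rw [hKz] at hKα
    exact hα (hb α hKα.1 hKα.2)
  let P : MvPolynomial J ℝ := (∏ j, MvPolynomial.X j) *
    ∏ v, ∏ i ∈ Finset.range (Fintype.card J), (K v i).det
  have hP : P ≠ 0 := by
    refine mul_ne_zero (Finset.prod_ne_zero_iff.2 fun j _ => MvPolynomial.X_ne_zero j)
      (Finset.prod_ne_zero_iff.2 fun v _ => Finset.prod_ne_zero_iff.2 fun i hi =>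
        hdet v i (Finset.mem_range.1 hi))
  obtain ⟨b, hb⟩ : ∃ b, MvPolynomial.eval b P ≠ 0 := by
    by_contra! h
    exact hP (MvPolynomial.funext fun b => by rw [h b, map_zero])
  simp only [P, map_mul, map_prod, MvPolynomial.eval_X] at hb
  refine ⟨b, fun j => Finset.prod_ne_zero_iff.1 (left_ne_zero_of_mul hb) j (Finset.mem_univ j),
    fun v i hi α h1 h2 => ?_⟩
  have h3 := Finset.prod_ne_zero_iff.1 (Finset.prod_ne_zero_iff.1 (right_ne_zero_of_mul hb) v
    (Finset.mem_univ v)) i (Finset.mem_range.2 hi)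
  by_contra hα
  rw [RingHom.map_det] at h3
  exact h3 (Matrix.exists_mulVec_eq_zero_iff.mp ⟨α, hα, (hKz v i b α).2 ⟨h1, h2⟩⟩)

/-- Any simple spectrum is realised by a matrix of the path, with an eigenbasis in general
position with respect to finitely many prescribed vectors. -/
theorem exists_path_diagonalization {J V : Type*} [Fintype J] [DecidableEq J] [Fintype V] {m : ℕ}
    (hm : Fintype.card J = m) {d : J → ℝ} (hd : Function.Injective d)
    {z : V → J → ℝ} (hz : ∀ v, z v ≠ 0) :
    ∃ W : Matrix (Fin m) J ℝ, W * W.transpose = 1 ∧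
      W * Matrix.diagonal d * W.transpose ∈ matricesOfGraph (SimpleGraph.pathGraph m) ∧
      ∀ v i, W.mulVec (z v) i ≠ 0 := by
  classical
  obtain ⟨b, hb, hbz⟩ := exists_generic_krylov hd hz
  let f : Fin m → EuclideanSpace ℝ J := fun i => WithLp.toLp 2 fun j => d j ^ (i : ℕ) * b j
  have hf : LinearIndependent ℝ f := by
    rw [Fintype.linearIndependent_iff]
    intro g hg
    have h1 : ∑ i, Polynomial.C (g i) * Polynomial.X ^ (i : ℕ) = 0 := by
      refine Polynomial.eq_zero_of_degree_lt_of_eval_index_eq_zero Finset.univ (v := d) hd.injOn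
        ?_ ?_
      · rw [Finset.card_univ, hm]
        exact Polynomial.degree_sum_fin_lt g
      · intro j _
        have h2 := congrFun (congrArg WithLp.ofLp hg) j
        simp only [WithLp.ofLp_sum, WithLp.ofLp_smul, Finset.sum_apply, Pi.smul_apply, f,
          smul_eq_mul, WithLp.ofLp_zero, Pi.zero_apply] at h2
        have h3 : (∑ i, g i * d j ^ (i : ℕ)) * b j = 0 := by
          rw [Finset.sum_mul, ← h2]
          exact Finset.sum_congr rfl fun i _ => by ring
        simpa [Polynomial.eval_finsetSum] using (mul_eq_zero.mp h3).resolve_right (hb j)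
    intro i
    have := congrArg (fun q => q.coeff (i : ℕ)) h1
    simpa [Polynomial.finsetSum_coeff, Polynomial.coeff_X_pow, Fin.val_inj] using this
  let w := InnerProductSpace.gramSchmidtNormed ℝ f
  have hw : Orthonormal ℝ w := InnerProductSpace.gramSchmidtNormed_orthonormal hf
  have hIic : ∀ i, Submodule.span ℝ (w '' Set.Iic i) = Submodule.span ℝ (f '' Set.Iic i) :=
    fun i => (InnerProductSpace.span_gramSchmidtNormed f _).trans
      (InnerProductSpace.span_gramSchmidt_Iic ℝ f i)
  have hIio : ∀ i, Submodule.span ℝ (w '' Set.Iio i) = Submodule.span ℝ (f '' Set.Iio i) :=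
    fun i => (InnerProductSpace.span_gramSchmidtNormed f _).trans
      (InnerProductSpace.span_gramSchmidt_Iio ℝ f i)
  have hmem : ∀ i, w i ∈ Submodule.span ℝ (f '' Set.Iic i) := fun i => by
    rw [← hIic]
    exact Submodule.subset_span ⟨i, Set.self_mem_Iic, rfl⟩
  have horth : ∀ i, ∀ x ∈ Submodule.span ℝ (f '' Set.Iio i), inner ℝ (w i) x = 0 := by
    intro i x hx
    rw [← hIio] at hx
    induction hx using Submodule.span_induction with
    | mem x hx =>
      obtain ⟨k, hk, rfl⟩ := hx
      exact hw.2 (ne_of_gt hk)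
    | zero => simp
    | add x y _ _ hx hy => rw [inner_add_right, hx, hy, add_zero]
    | smul a x _ hx => rw [inner_smul_right, hx, mul_zero]
  have hself : ∀ i, inner ℝ (w i) (w i) = 1 := fun i => by
    rw [real_inner_self_eq_norm_sq, hw.1 i, one_pow]
  let T : EuclideanSpace ℝ J →ₗ[ℝ] EuclideanSpace ℝ J := Matrix.toEuclideanLin (Matrix.diagonal d)
  have hT : ∀ x j, T x j = d j * x j := fun x j => by
    simp [T, Matrix.toLpLin_apply, Matrix.mulVec_diagonal]
  have hTf : ∀ i k : Fin m, (i : ℕ) + 1 = k → T (f i) = f k := fun i k h => by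
    ext j
    rw [hT]
    simp only [f]
    rw [← h]
    ring
  have hTspan : ∀ i k : Fin m, (i : ℕ) + 1 < k → ∀ x ∈ Submodule.span ℝ (f '' Set.Iic i),
      T x ∈ Submodule.span ℝ (f '' Set.Iio k) := by
    intro i k hik x hx
    induction hx using Submodule.span_induction with
    | mem x hx =>
      obtain ⟨c, hc, rfl⟩ := hx
      have hc' : (c : ℕ) ≤ i := hc
      rw [hTf c ⟨c + 1, by omega⟩ rfl]
      exact Submodule.subset_span ⟨_, by simp only [Set.mem_Iio, Fin.lt_def]; omega, rfl⟩
    | zero => rw [map_zero]; exact Submodule.zero_mem _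
    | add x y _ _ hx hy => rw [map_add]; exact Submodule.add_mem _ hx hy
    | smul a x _ hx => rw [map_smul]; exact Submodule.smul_mem _ _ hx
  have hfar : ∀ i k : Fin m, (i : ℕ) + 1 < k → inner ℝ (w k) (T (w i)) = 0 := fun i k h =>
    horth k _ (hTspan i k h _ (hmem i))
  have hnext : ∀ i k : Fin m, (i : ℕ) + 1 = k → inner ℝ (w k) (T (w i)) ≠ 0 := by
    intro i k hik h0
    have h1 : ∀ x ∈ Submodule.span ℝ (f '' Set.Iic i), inner ℝ (w k) (T x) = 0 := by
      intro x hx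
      rw [← hIic] at hx
      induction hx using Submodule.span_induction with
      | mem x hx =>
        obtain ⟨c, hc, rfl⟩ := hx
        rcases (Set.mem_Iic.1 hc).eq_or_lt with h | h
        · rw [h, h0]
        · exact hfar c k (by rw [Fin.lt_def] at h; omega)
      | zero => simp
      | add x y _ _ hx hy => rw [map_add, inner_add_right, hx, hy, add_zero]
      | smul a x _ hx => rw [map_smul, inner_smul_right, hx, mul_zero]
    have h2 : ∀ x ∈ Submodule.span ℝ (f '' Set.Iic k), inner ℝ (w k) x = 0 := by
      intro x hx
      induction hx using Submodule.span_induction with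
      | mem x hx =>
        obtain ⟨c, hc, rfl⟩ := hx
        rcases (Set.mem_Iic.1 hc).eq_or_lt with h | h
        · rw [h, ← hTf i k hik]
          exact h1 _ (Submodule.subset_span ⟨i, Set.self_mem_Iic, rfl⟩)
        · exact horth k _ (Submodule.subset_span ⟨c, h, rfl⟩)
      | zero => simp
      | add x y _ _ hx hy => rw [inner_add_right, hx, hy, add_zero]
      | smul a x _ hx => rw [inner_smul_right, hx, mul_zero]
    have h3 := h2 _ (hmem k)
    rw [hself] at h3
    exact one_ne_zero h3
  have hinner : ∀ x y : EuclideanSpace ℝ J, inner ℝ x y = ∑ j, x j * y j := fun x y => by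
    simp [PiLp.inner_apply, mul_comm]
  let W : Matrix (Fin m) J ℝ := Matrix.of fun i j => w i j
  have hB : ∀ i k, (W * Matrix.diagonal d * W.transpose) i k = inner ℝ (w i) (T (w k)) := by
    intro i k
    rw [Matrix.mul_apply, hinner]
    refine Finset.sum_congr rfl fun j _ => ?_
    rw [Matrix.mul_diagonal, Matrix.transpose_apply, hT]
    simp only [W, Matrix.of_apply]
    ring
  have hsymm : (W * Matrix.diagonal d * W.transpose).IsSymm := by
    rw [Matrix.IsSymm, Matrix.transpose_mul, Matrix.transpose_mul, Matrix.transpose_transpose,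
      Matrix.diagonal_transpose, Matrix.mul_assoc]
  have hoff : ∀ i k : Fin m, i < k → ((W * Matrix.diagonal d * W.transpose) k i ≠ 0 ↔
      (SimpleGraph.pathGraph m).Adj k i) := by
    intro i k hik
    rw [hB, SimpleGraph.pathGraph_adj]
    rw [Fin.lt_def] at hik
    constructor
    · intro h
      by_contra hcon
      exact h (hfar i k (by omega))
    · intro h
      exact hnext i k (by omega)
  refine ⟨W, ?_, ⟨hsymm, fun i k hik => ?_⟩, fun v i hvi => ?_⟩
  · ext i k
    have h1 : (W * W.transpose) i k = inner ℝ (w i) (w k) := by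
      rw [Matrix.mul_apply, hinner]
      rfl
    rw [h1]
    by_cases h : i = k
    · subst h
      rw [hself, Matrix.one_apply_eq]
    · rw [hw.2 h, Matrix.one_apply_ne h]
  · rcases lt_or_gt_of_ne hik with h | h
    · rw [SimpleGraph.adj_comm, ← hoff i k h, hsymm.apply]
    · exact hoff k i h
  · have h1 : w i ∈ Submodule.span ℝ (Set.range fun c : Fin ((i : ℕ) + 1) =>
        f ⟨c, by omega⟩) := by
      refine Submodule.span_mono ?_ (hmem i)
      rintro _ ⟨c, hc, rfl⟩
      have hc' : (c : ℕ) ≤ i := hc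
      exact ⟨⟨c, by omega⟩, rfl⟩
    obtain ⟨α, hα⟩ := (Submodule.mem_span_range_iff_exists_fun ℝ).1 h1
    have hwi : ∀ j, w i j = (∑ c, α c * d j ^ (c : ℕ)) * b j := fun j => by
      rw [← hα, Finset.sum_mul]
      simp only [WithLp.ofLp_sum, WithLp.ofLp_smul, Finset.sum_apply, Pi.smul_apply, f,
          smul_eq_mul]
      exact Finset.sum_congr rfl fun c _ => by ring
    have hα0 : α = 0 := by
      refine hbz v i (by omega) α (fun a ha => ?_) ?_
      · have h2 := horth i (f ⟨a, by omega⟩)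
          (Submodule.subset_span ⟨⟨a, by omega⟩, by simpa [Fin.lt_def] using ha, rfl⟩)
        rw [hinner] at h2
        rw [← h2]
        refine Finset.sum_congr rfl fun j _ => ?_
        rw [hwi]
        simp only [f]
        ring
      · rw [← hvi]
        simp only [Matrix.mulVec, dotProduct, W, Matrix.of_apply, hwi]
        exact Finset.sum_congr rfl fun j _ => by ring
    have hw0 : w i = 0 := by
      rw [← hα, hα0]
      simp
    have := hself i
    rw [hw0, inner_zero_left] at this
    exact zero_ne_one this

/-- The eigenvalue equation of `Q * M * Qᵀ` in the coordinates given by the block orthogonal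
matrix `Q = diag(U, W)`. -/
theorem fromBlocks_conj_mulVec_eq_smul {V I J : Type*} [Fintype V] [Fintype I] [Fintype J]
    [DecidableEq V] [DecidableEq I] [DecidableEq J]
    {U : Matrix V V ℝ} {W : Matrix I J ℝ} (hU : U.transpose * U = 1) (hW : W.transpose * W = 1)
    {c : V → ℝ} {d : J → ℝ} {Y : Matrix V J ℝ} {x : ℝ} {a : V → ℝ} {u : I → ℝ}
    (h : (Matrix.fromBlocks (U * Matrix.diagonal c * U.transpose) (U * Y * W.transpose)
      (W * Y.transpose * U.transpose) (W * Matrix.diagonal d * W.transpose)).mulVec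
        (Sum.elim a u) = x • Sum.elim a u) :
    (∀ v, c v * U.transpose.mulVec a v + ∑ j, Y v j * W.transpose.mulVec u j =
      x * U.transpose.mulVec a v) ∧
    (∀ j, ∑ v, Y v j * U.transpose.mulVec a v + d j * W.transpose.mulVec u j =
      x * W.transpose.mulVec u j) := by
  rw [Matrix.fromBlocks_mulVec] at h
  have h1 : (U * Matrix.diagonal c * U.transpose).mulVec a + (U * Y * W.transpose).mulVec u =
      x • a := by
    ext v
    exact congrFun h (Sum.inl v)
  have h2 : (W * Y.transpose * U.transpose).mulVec a +
      (W * Matrix.diagonal d * W.transpose).mulVec u = x • u := by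
    ext v
    exact congrFun h (Sum.inr v)
  have h3 := congrArg U.transpose.mulVec h1
  have h4 := congrArg W.transpose.mulVec h2
  rw [Matrix.mulVec_add, Matrix.mulVec_mulVec, Matrix.mulVec_mulVec, Matrix.mulVec_smul,
    Matrix.mul_assoc U, Matrix.mul_assoc U, ← Matrix.mul_assoc _ U, ← Matrix.mul_assoc _ U, hU,
    Matrix.one_mul, Matrix.one_mul, ← Matrix.mulVec_mulVec, ← Matrix.mulVec_mulVec] at h3
  rw [Matrix.mulVec_add, Matrix.mulVec_mulVec, Matrix.mulVec_mulVec, Matrix.mulVec_smul,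
    Matrix.mul_assoc W, Matrix.mul_assoc W, ← Matrix.mul_assoc _ W, ← Matrix.mul_assoc _ W, hW,
    Matrix.one_mul, Matrix.one_mul, ← Matrix.mulVec_mulVec, ← Matrix.mulVec_mulVec] at h4
  refine ⟨fun v => ?_, fun j => ?_⟩
  · have := congrFun h3 v
    rw [Pi.add_apply, Matrix.mulVec_diagonal, Pi.smul_apply, smul_eq_mul] at this
    exact this
  · have := congrFun h4 j
    rw [Pi.add_apply, Matrix.mulVec_diagonal, Pi.smul_apply, smul_eq_mul] at this
    exact this

theorem exists_mulVec_eq_smul_of_mem_spectrum {I : Type*} [Fintype I] [DecidableEq I]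
    {A : Matrix I I ℝ} {x : ℝ} (hx : x ∈ spectrum ℝ A) : ∃ y, y ≠ 0 ∧ A.mulVec y = x • y := by
  rw [spectrum.mem_iff, Matrix.isUnit_iff_isUnit_det, isUnit_iff_ne_zero, not_not] at hx
  obtain ⟨y, hy, h⟩ := Matrix.exists_mulVec_eq_zero_iff.mpr hx
  refine ⟨y, hy, ?_⟩
  rw [Matrix.sub_mulVec, sub_eq_zero, Algebra.algebraMap_eq_smul_one, Matrix.smul_mulVec,
    Matrix.one_mulVec] at h
  exact h.symm

/-- The shaft of the arrow matrix with corner `c` and eigenvalues `0, 2, …, 2 s`. -/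
noncomputable def evenShaft (c : ℝ) (s : ℕ) (i : Fin s) : ℝ := 2 * ((i : ℕ) + 1) - c / s

/-- The even numbers `0, 2, …, 2 s`. -/
def evenNodes (s : ℕ) (i : Fin (s + 1)) : ℝ := 2 * (i : ℕ)

theorem strictMono_evenNodes (s : ℕ) : StrictMono (evenNodes s) := fun i j h => by
  have : ((i : ℕ) : ℝ) < (j : ℕ) := by exact_mod_cast h
  simp only [evenNodes]
  linarith

theorem eq_sum_evenNodes_sub_sum_evenShaft {c : ℝ} {s : ℕ} (hs : 1 ≤ s) :
    c = ∑ i, evenNodes s i - ∑ i, evenShaft c s i := by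
  have hs0 : (s : ℝ) ≠ 0 := by positivity
  rw [Fin.sum_univ_succ]
  simp only [evenNodes, evenShaft, Finset.sum_sub_distrib, Fin.val_succ]
  simp
  field_simp

/-- Given `1 ≤ s v < k` and `t ≤ k` with `∑ v, s v + t = m`, there is a matrix of `G ∨ P_m` with
spectrum contained in `{0, 2, …, 2 (k - 1)}`. -/
theorem exists_numDistinctEigenvalues_le {V : Type*} [Fintype V] [DecidableEq V]
    (G : SimpleGraph V) {m k t : ℕ} {s : V → ℕ} (hs1 : ∀ v, 1 ≤ s v) (hsk : ∀ v, s v < k)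
    (ht : t ≤ k) (hsum : ∑ v, s v + t = m) :
    ∃ A ∈ matricesOfGraph (graphJoin G (SimpleGraph.pathGraph m)),
      numDistinctEigenvalues A ≤ k := by
  classical
  obtain ⟨U, l, hU, hl, hC⟩ := exists_mem_matricesOfGraph_injective_eigenvalues G
  have hU' : U.transpose * U = 1 := mul_eq_one_comm.mp hU
  obtain ⟨ε, hε, hεl⟩ : ∃ ε : ℝ, 0 < ε ∧ ∀ v, |ε * l v| * (4 * k + 4) ≤ 1 := by
    have hB : 0 < ∑ v, |l v| + 1 := by positivity
    refine ⟨1 / ((4 * k + 4) * (∑ v, |l v| + 1)), by positivity, fun v => ?_⟩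
    rw [abs_mul, abs_of_pos (by positivity)]
    have h1 : |l v| ≤ ∑ v, |l v| + 1 := by
      have := Finset.single_le_sum (f := fun v => |l v|) (fun v _ => abs_nonneg _)
        (Finset.mem_univ v)
      linarith
    have h2 : 1 / ((4 * (k : ℝ) + 4) * (∑ v, |l v| + 1)) * |l v| * (4 * k + 4) =
        |l v| / (∑ v, |l v| + 1) := by
      field_simp
    rw [h2, div_le_one hB]
    exact h1
  have hk0 : (0 : ℝ) ≤ k := by positivity
  have hεb : ∀ v, |ε * l v| ≤ 1 / 4 := fun v => by
    have := hεl v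
    have := abs_nonneg (ε * l v)
    nlinarith
  let c : V → ℝ := fun v => 1 + ε * l v
  have hc0 : ∀ v, 3 / 4 ≤ c v := fun v => by
    have := (abs_le.1 (hεb v)).1
    simp only [c]
    linarith
  have hc1 : ∀ v, c v ≤ 5 / 4 := fun v => by
    have := (abs_le.1 (hεb v)).2
    simp only [c]
    linarith
  have hs1' : ∀ v, (1 : ℝ) ≤ s v := fun v => by exact_mod_cast hs1 v
  have hγ0 : ∀ v, 0 < c v / s v := fun v =>
    div_pos (by linarith [hc0 v]) (by linarith [hs1' v])
  have hγ2 : ∀ v, c v / s v < 2 := fun v => by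
    rw [div_lt_iff₀ (by linarith [hs1' v])]
    linarith [hs1' v, hc1 v]
  have hγaux : ∀ v w, c v * s w = c w * s v → ¬ s v < s w := by
    intro v w h hlt
    have h1 : (s v : ℝ) + 1 ≤ s w := by exact_mod_cast hlt
    have h2 : (s v : ℝ) ≤ k := by exact_mod_cast (hsk v).le
    have h3 : c v * (s v + 1) ≤ c v * s w :=
      mul_le_mul_of_nonneg_left h1 (by linarith [hc0 v])
    have h4 : (c w - c v) * s v ≤ (|ε * l w| + |ε * l v|) * k := by
      refine mul_le_mul ?_ h2 (by positivity) (by positivity)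
      simp only [c]
      linarith [le_abs_self (ε * l w), neg_abs_le (ε * l v)]
    have h5 := hεl v
    have h6 := hεl w
    have h7 := hc0 v
    have := abs_nonneg (ε * l v)
    have := abs_nonneg (ε * l w)
    nlinarith
  have hγ : ∀ v w, c v / s v = c w / s w → v = w := by
    intro v w h
    rw [div_eq_div_iff (by linarith [hs1' v]) (by linarith [hs1' w])] at h
    have hsw : s v = s w :=
      le_antisymm (not_lt.1 (hγaux w v h.symm)) (not_lt.1 (hγaux v w h))
    rw [hsw] at h
    have h1 := mul_right_cancel₀ (by linarith [hs1' w]) h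
    exact hl (mul_left_cancel₀ hε.ne' (add_left_cancel h1))
  let d : (Σ v, Fin (s v)) ⊕ Fin t → ℝ :=
    Sum.elim (fun p => evenShaft (c p.1) (s p.1) p.2) (fun i => 2 * ((i : ℕ) : ℝ))
  have hne : ∀ (p : Σ v, Fin (s v)) (i : ℕ), evenShaft (c p.1) (s p.1) p.2 ≠ 2 * (i : ℝ) := by
    intro p i h
    simp only [evenShaft] at h
    have h0 := hγ0 p.1
    have h2 := hγ2 p.1
    have h3 : ((p.2 : ℕ) : ℝ) < i := by linarith
    have h4 : (i : ℝ) < (p.2 : ℕ) + 1 := by linarith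
    have h5 : (p.2 : ℕ) < i := by exact_mod_cast h3
    have h6 : i < (p.2 : ℕ) + 1 := by exact_mod_cast h4
    omega
  have hd : Function.Injective d := by
    rintro (⟨v, i⟩ | i) (⟨w, j⟩ | j) h
    · simp only [d, Sum.elim_inl, evenShaft] at h
      have h3 : ((i : ℕ) : ℝ) < (j : ℕ) + 1 := by linarith [hγ0 v, hγ2 v, hγ0 w, hγ2 w]
      have h4 : ((j : ℕ) : ℝ) < (i : ℕ) + 1 := by linarith [hγ0 v, hγ2 v, hγ0 w, hγ2 w]
      have h5 : (i : ℕ) < j + 1 := by exact_mod_cast h3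
      have h6 : (j : ℕ) < i + 1 := by exact_mod_cast h4
      have h7 : (i : ℕ) = j := by omega
      rw [h7] at h
      obtain rfl := hγ v w (by linarith)
      obtain rfl := Fin.ext h7
      rfl
    · exact absurd h (hne ⟨v, i⟩ j)
    · exact absurd h.symm (hne ⟨w, j⟩ i)
    · simp only [d, Sum.elim_inr] at h
      have : ((i : ℕ) : ℝ) = (j : ℕ) := by linarith
      rw [Fin.ext (by exact_mod_cast this : (i : ℕ) = j)]
  have hlt1 : ∀ v (i : Fin (s v)), evenNodes (s v) i.castSucc < evenShaft (c v) (s v) i :=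
    fun v i => by
      simp only [evenNodes, evenShaft, Fin.val_castSucc]
      linarith [hγ2 v]
  have hlt2 : ∀ v (i : Fin (s v)), evenShaft (c v) (s v) i < evenNodes (s v) i.succ :=
    fun v i => by
      simp only [evenNodes, evenShaft, Fin.val_succ]
      push_cast
      linarith [hγ0 v]
  let η : (v : V) → Fin (s v) → ℝ := fun v i =>
    √(arrowWeight (evenNodes (s v)) (evenShaft (c v) (s v)) i)
  have hη : ∀ v i, η v i ≠ 0 := fun v i => (Real.sqrt_pos.2
    (arrowWeight_pos (strictMono_evenNodes _) (hlt1 v) (hlt2 v) i)).ne'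
  let Y : Matrix V ((Σ v, Fin (s v)) ⊕ Fin t) ℝ := Matrix.of fun v =>
    Sum.elim (fun p => if p.1 = v then η p.1 p.2 else 0) (fun _ => 0)
  have hYl : ∀ v p, Y v (Sum.inl p) = if p.1 = v then η p.1 p.2 else 0 := fun _ _ => rfl
  have hYr : ∀ v i, Y v (Sum.inr i) = 0 := fun _ _ => rfl
  have hz : ∀ v, (U * Y) v ≠ 0 := by
    intro v h
    have hrow : ∀ w, U v w = 0 := by
      intro w
      have h1 : (U * Y) v (Sum.inl ⟨w, ⟨0, hs1 w⟩⟩) = 0 := congrFun h _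
      rw [Matrix.mul_apply] at h1
      simp only [hYl, mul_ite, mul_zero, Finset.sum_ite_eq, Finset.mem_univ, if_true] at h1
      exact (mul_eq_zero.mp h1).resolve_right (hη _ _)
    have h2 : (U * U.transpose) v v = 1 := by rw [hU, Matrix.one_apply_eq]
    rw [Matrix.mul_apply, Finset.sum_eq_zero (fun w _ => by rw [hrow w, zero_mul])] at h2
    exact zero_ne_one h2
  have hcard : Fintype.card ((Σ v, Fin (s v)) ⊕ Fin t) = m := by simp [hsum]
  obtain ⟨W, hW, hB, hWz⟩ := exists_path_diagonalization hcard hd hz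
  have hW' : W.transpose * W = 1 :=
    (Matrix.mul_eq_one_comm_of_card_eq _ _ _ (by rw [hcard, Fintype.card_fin])).mp hW
  have hX : ∀ v i, (U * Y * W.transpose) v i ≠ 0 := by
    intro v i
    have h1 : (U * Y * W.transpose) v i = W.mulVec ((U * Y) v) i := by
      rw [Matrix.mul_apply, Matrix.mulVec, dotProduct]
      exact Finset.sum_congr rfl fun j _ => mul_comm _ _
    rw [h1]
    exact hWz v i
  have hXt : W * Y.transpose * U.transpose = (U * Y * W.transpose).transpose := by
    simp [Matrix.transpose_mul, Matrix.mul_assoc]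
  have hC' : U * Matrix.diagonal c * U.transpose =
      1 + ε • (U * Matrix.diagonal l * U.transpose) := by
    have h1 : Matrix.diagonal c = 1 + ε • Matrix.diagonal l := by
      ext i j
      by_cases h : i = j <;> simp [h, c]
    rw [h1, mul_add, add_mul, mul_one, hU, Matrix.mul_smul, Matrix.smul_mul]
  refine ⟨Matrix.fromBlocks (U * Matrix.diagonal c * U.transpose) (U * Y * W.transpose)
      (W * Y.transpose * U.transpose) (W * Matrix.diagonal d * W.transpose), ⟨?_, ?_⟩, ?_⟩
  · rw [hXt, Matrix.isSymm_fromBlocks_iff]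
    refine ⟨?_, rfl, Matrix.transpose_transpose _, hB.1⟩
    rw [hC', Matrix.IsSymm, Matrix.transpose_add, Matrix.transpose_one, Matrix.transpose_smul,
      hC.1.eq]
  · rintro (v | i) (w | j) hij
    · have hvw : v ≠ w := fun h => hij (congrArg _ h)
      rw [Matrix.fromBlocks_apply₁₁, hC', graphJoin_adj_inl_inl, ← hC.2 v w hvw,
        Matrix.add_apply, Matrix.one_apply_ne hvw, zero_add, Matrix.smul_apply, smul_eq_mul]
      simp [hε.ne']
    · rw [Matrix.fromBlocks_apply₁₂]
      exact iff_of_true (hX v j) graphJoin_adj_inl_inr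
    · rw [Matrix.fromBlocks_apply₂₁, hXt, Matrix.transpose_apply]
      exact iff_of_true (hX w i) graphJoin_adj_inr_inl
    · rw [Matrix.fromBlocks_apply₂₂, graphJoin_adj_inr_inr]
      exact hB.2 i j fun h => hij (congrArg _ h)
  · have hsub : spectrum ℝ (Matrix.fromBlocks (U * Matrix.diagonal c * U.transpose)
        (U * Y * W.transpose) (W * Y.transpose * U.transpose)
        (W * Matrix.diagonal d * W.transpose)) ⊆
        ((Finset.range k).image fun i : ℕ => 2 * (i : ℝ) : Finset ℝ) := by
      intro x hx
      obtain ⟨y, hy, hyx⟩ := exists_mulVec_eq_smul_of_mem_spectrum hx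
      by_contra hxk
      have hxk' : ∀ i < k, x ≠ 2 * (i : ℝ) := fun i hi h => hxk (by
        rw [Finset.coe_image]
        exact ⟨i, by simpa using hi, h.symm⟩)
      apply hy
      rw [← Sum.elim_comp_inl_inr y] at hyx
      obtain ⟨h1, h2⟩ := fromBlocks_conj_mulVec_eq_smul hU' hW' hyx
      set a := U.transpose.mulVec (y ∘ Sum.inl) with ha
      set u := W.transpose.mulVec (y ∘ Sum.inr) with hu
      have hblock : ∀ v, a v = 0 ∧ ∀ i, u (Sum.inl ⟨v, i⟩) = 0 := by
        intro v
        refine arrow_eigenvector_eq_zero (strictMono_evenNodes (s v)) (hlt1 v) (hlt2 v)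
          (eq_sum_evenNodes_sub_sum_evenShaft (hs1 v)) (x := x) ?_ ?_ ?_
        · intro i
          exact hxk' i (by have := i.2; have := hsk v; omega)
        · rw [← h1 v]
          congr 1
          rw [Fintype.sum_sum_type, Fintype.sum_sigma, Finset.sum_eq_single v]
          · simp [hYl, hYr, η]
          · intro w _ hw
            exact Finset.sum_eq_zero fun i _ => by rw [hYl, if_neg hw, zero_mul]
          · simp
        · intro i
          have := h2 (Sum.inl ⟨v, i⟩)
          simp only [hYl, ite_mul, zero_mul, Finset.sum_ite_eq, Finset.mem_univ, if_true] at this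
          exact this
      have ha0 : a = 0 := funext fun v => (hblock v).1
      have hu0 : u = 0 := by
        ext (⟨v, i⟩ | i)
        · exact (hblock v).2 i
        · have h3 := h2 (Sum.inr i)
          simp only [hYr, zero_mul, Finset.sum_const_zero, zero_add] at h3
          have h4 : (x - d (Sum.inr i)) * u (Sum.inr i) = 0 := by linear_combination -h3
          refine (mul_eq_zero.mp h4).resolve_left (sub_ne_zero.2 ?_)
          exact hxk' i (lt_of_lt_of_le i.2 ht)
      have ha1 : y ∘ Sum.inl = 0 := by
        rw [← Matrix.one_mulVec (y ∘ Sum.inl), ← hU, ← Matrix.mulVec_mulVec, ← ha, ha0,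
          Matrix.mulVec_zero]
      have hu1 : y ∘ Sum.inr = 0 := by
        rw [← Matrix.one_mulVec (y ∘ Sum.inr), ← hW, ← Matrix.mulVec_mulVec, ← hu, hu0,
          Matrix.mulVec_zero]
      ext (v | i)
      · exact congrFun ha1 v
      · exact congrFun hu1 i
    rw [numDistinctEigenvalues]
    refine (Set.ncard_le_ncard hsub (Finset.finite_toSet _)).trans ?_
    rw [Set.ncard_coe_finset]
    exact Finset.card_image_le.trans (by simp)

/-- An integer `m ≥ n` is spread over `n` parts of size between `1` and `k - 1`, leaving at most
`k` as remainder. -/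
theorem exists_balanced_parts {V : Type*} [Fintype V] [Nonempty V] {m k : ℕ} (hk : 2 ≤ k)
    (hm : Fintype.card V ≤ m) (hmk : Fintype.card V + m ≤ k * (Fintype.card V + 1)) :
    ∃ (s : V → ℕ) (t : ℕ), (∀ v, 1 ≤ s v) ∧ (∀ v, s v < k) ∧ t ≤ k ∧ ∑ v, s v + t = m := by
  obtain ⟨e⟩ : Nonempty (V ≃ Fin (Fintype.card V)) := ⟨Fintype.equivFin V⟩
  have hn : 0 < Fintype.card V := Fintype.card_pos
  set n := Fintype.card V with hn'
  obtain ⟨k, rfl⟩ : ∃ k', k = k' + 1 := ⟨k - 1, by omega⟩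
  rcases Nat.lt_or_ge m (n * k) with h | h
  · have hq : m / n < k := Nat.div_lt_of_lt_mul h
    have hq1 : 1 ≤ m / n := (Nat.one_le_div_iff hn).2 hm
    have hr : m % n < n := Nat.mod_lt m hn
    refine ⟨fun v => m / n + if (e v : ℕ) < m % n then 1 else 0, 0, fun v => le_add_right hq1,
      fun v => ?_, by omega, ?_⟩
    · dsimp only
      split_ifs <;> omega
    · have h1 : ∑ v, (if (e v : ℕ) < m % n then 1 else 0) = m % n := by
        rw [Equiv.sum_comp e (fun i : Fin n => if (i : ℕ) < m % n then 1 else 0),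
          Fin.sum_univ_eq_sum_range (fun i => if i < m % n then 1 else 0), Finset.sum_boole,
          show (Finset.range n).filter (fun i => i < m % n) = Finset.range (m % n) by
            ext i; simp only [Finset.mem_filter, Finset.mem_range]; omega]
        simp
      rw [Finset.sum_add_distrib, h1, Finset.sum_const, Finset.card_univ, smul_eq_mul, ← hn',
        add_zero]
      exact Nat.div_add_mod m n
  · refine ⟨fun _ => k, m - n * k, fun _ => Nat.le_of_lt_succ hk, fun _ => Nat.lt_succ_self k,
      ?_, ?_⟩
    · have : (k + 1) * (n + 1) = n * k + n + k + 1 := by ring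
      omega
    · rw [Finset.sum_const, Finset.card_univ, smul_eq_mul, ← hn']
      omega

theorem corollary2p3 {V : Type*} [Fintype V] [DecidableEq V] (G : SimpleGraph V)
    (hG : G.Connected) (n m : ℕ) (hn : Fintype.card V = n) (hm : 1 < m) (hnm : n ≤ m) :
    minDistinctEigenvalues (graphJoin G (SimpleGraph.pathGraph m)) =
      ⌈((n : ℝ) + (m : ℝ)) / ((n : ℝ) + 1)⌉₊ := by
  subst hn
  have hV : Nonempty V := hG.nonempty
  have hpos : (0 : ℝ) < (Fintype.card V : ℝ) + 1 := by positivity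
  apply le_antisymm
  · set k := ⌈((Fintype.card V : ℝ) + (m : ℝ)) / ((Fintype.card V : ℝ) + 1)⌉₊ with hk
    have h1 : 1 < k := by
      rw [hk, Nat.lt_ceil, Nat.cast_one, one_lt_div hpos]
      have : (1 : ℝ) < m := by exact_mod_cast hm
      linarith
    have h2 : Fintype.card V + m ≤ k * (Fintype.card V + 1) := by
      have := Nat.le_ceil (((Fintype.card V : ℝ) + (m : ℝ)) / ((Fintype.card V : ℝ) + 1))
      rw [← hk, div_le_iff₀ hpos] at this
      exact_mod_cast this
    obtain ⟨s, t, hs1, hsk, ht, hsum⟩ := exists_balanced_parts (V := V) h1 hnm h2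
    obtain ⟨A, hA, hAk⟩ := exists_numDistinctEigenvalues_le G hs1 hsk ht hsum
    exact ((isLeast_minDistinctEigenvalues _).2 ⟨A, hA, rfl⟩).trans hAk
  · obtain ⟨A, hA, hq⟩ := (isLeast_minDistinctEigenvalues
      (graphJoin G (SimpleGraph.pathGraph m))).1
    rw [← hq, Nat.ceil_le, div_le_iff₀ hpos]
    have := card_add_le_mul_numDistinctEigenvalues (by omega) hA
    rw [mul_comm] at this
    exact_mod_cast this
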